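/- Let $E=(E^0,E^1,r,s)$ be a finite directed graph (finite sets $E^0$ of vertices and $E^1$ of edges, with range and source maps $r,s:E^1\to E^0$; loops and parallel edges are allowed) and let $K$ be any field. Let $L_K(E)$ be the Leavitt path algebra of $E$ over $K$: the $K$-algebra generated by the symbols $v$ ($v\in E^0$), $e$ and $e^*$ ($e\in E^1$) subject to (V) $vw=\delta_{v,w}v$ for $v,w\in E^0$; (E1) $s(e)e=e\,r(e)=e$ and (E2) $r(e)e^*=e^*s(e)=e^*$ for $e\in E^1$; (CK1) $e^*f=\delta_{e,f}\,r(e)$ for $e,f\in E^1$; (CK2) $v=\sum_{s(e)=v}ee^*$ for every $v\in E^0$ that emits at least one edge; it is unital with $1=\sum_{v\in E^0}v$. Grade $L_K(E)$ over $\mathbb{Z}$ by path length: the component of degree $n$ is the $K$-span of all $\alpha\beta^*$ with $\alpha,\beta$ paths (possibly of length $0$, i.e. vertices), $r(\alpha)=r(\beta)$ and $\deg\alpha-\deg\beta=n$, where $\deg$ is the number of edges and $(e_1\cdots e_n)^*=e_n^*\cdots e_1^*$. A two-sided ideal is graded if it contains every homogeneous component of each of its elements. A closed simple path based at a vertex $v$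 is a path $e_1\cdots e_n$ with $n\ge 1$, $s(e_1)=r(e_n)=v$ and $s(e_i)\ne v$ for $i=2,\dots,n$. The graph $E$ satisfies Condition (K) if at every vertex there are based either zero or at least two closed simple paths. Then every two-sided ideal of $L_K(E)$ is graded if and only if $E$ satisfies Condition (K). Moreover, if exactly one closed simple path $\lambda$ is based at some vertex $v$, then the two-sided ideal generated by $v+\lambda$ is not graded. -/

import Mathlib

universe u v w

/-- A directed graph with vertex set `V` and edge set `A`; loops and parallel edges are allowed. -/
structure DirGraph (V : Type u) (A : Type v) where
  /-- the source of an edge -/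
  source : A → V
  /-- the range of an edge -/
  range : A → V

namespace DirGraph

variable {V : Type u} {A : Type v}

/-- `E.IsPath u w [e₁, …, eₙ]`: the edges `e₁, …, eₙ` form a path from `u` to `w`. The empty list
is the trivial path (of length zero) at a vertex `u = w`. -/
def IsPath (E : DirGraph V A) : V → V → List A → Prop
  | x, y, [] => x = y
  | x, y, e :: l => E.source e = x ∧ E.IsPath (E.range e) y l

/-- `e₁ … eₙ` is a closed simple path based at `x`: it is a path from `x` to `x` with `n ≥ 1`, and
`s(eᵢ) ≠ s(e₁) = x` for `i = 2, …, n`. -/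
def IsClosedSimplePath (E : DirGraph V A) (x : V) (l : List A) : Prop :=
  l ≠ [] ∧ E.IsPath x x l ∧ ∀ e ∈ l.tail, E.source e ≠ x

theorem isPath_concat (E : DirGraph V A) {x y : V} {l : List A} {e : A} (h : E.IsPath x y l) (he : E.source e = y) :
    E.IsPath x (E.range e) (l ++ [e]) := by
  induction l generalizing x with
  | nil =>
    have h' : x = y := h
    exact ⟨he.trans h'.symm, rfl⟩
  | cons f l ih => exact ⟨h.1, ih h.2⟩

/-- Condition (K): at every vertex there are either no closed simple paths or at least two. -/
def ConditionK (E : DirGraph V A) : Prop :=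
  ∀ x : V, (¬ ∃ l, E.IsClosedSimplePath x l) ∨
    ∃ l₁ l₂, E.IsClosedSimplePath x l₁ ∧ E.IsClosedSimplePath x l₂ ∧ l₁ ≠ l₂

end DirGraph

/-- The generators of the Leavitt path algebra: vertices, edges `e` and ghost edges `e*`. -/
inductive LeavittGen (V : Type u) (A : Type v) : Type (max u v)
  | vertex : V → LeavittGen V A
  | edge : A → LeavittGen V A
  | ghost : A → LeavittGen V A

open Classical in
/-- The defining relations of the Leavitt path algebra of a finite graph. As `FreeAlgebra` is the
unital free algebra, its unit is identified with the sum of the vertices, which is the unit of the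
algebra that the remaining relations define on the non-unital free algebra. The relation `ck2` is
imposed, as usual, at the vertices that emit an edge (sinks are not killed). -/
inductive LeavittRel (K : Type w) [Field K] {V : Type u} {A : Type v} [Fintype V] [Fintype A]
    (E : DirGraph V A) :
    FreeAlgebra K (LeavittGen V A) → FreeAlgebra K (LeavittGen V A) → Prop
  | one : LeavittRel K E 1 (∑ x : V, FreeAlgebra.ι K (.vertex x))
  | vertex_mul_self (x : V) : LeavittRel K E
      (FreeAlgebra.ι K (.vertex x) * FreeAlgebra.ι K (.vertex x)) (FreeAlgebra.ι K (.vertex x))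
  | vertex_mul_ne (x y : V) : x ≠ y → LeavittRel K E
      (FreeAlgebra.ι K (.vertex x) * FreeAlgebra.ι K (.vertex y)) 0
  | source_mul_edge (e : A) : LeavittRel K E
      (FreeAlgebra.ι K (.vertex (E.source e)) * FreeAlgebra.ι K (.edge e))
      (FreeAlgebra.ι K (.edge e))
  | edge_mul_range (e : A) : LeavittRel K E
      (FreeAlgebra.ι K (.edge e) * FreeAlgebra.ι K (.vertex (E.range e)))
      (FreeAlgebra.ι K (.edge e))
  | range_mul_ghost (e : A) : LeavittRel K E
      (FreeAlgebra.ι K (.vertex (E.range e)) * FreeAlgebra.ι K (.ghost e))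
      (FreeAlgebra.ι K (.ghost e))
  | ghost_mul_source (e : A) : LeavittRel K E
      (FreeAlgebra.ι K (.ghost e) * FreeAlgebra.ι K (.vertex (E.source e)))
      (FreeAlgebra.ι K (.ghost e))
  | ck1_self (e : A) : LeavittRel K E
      (FreeAlgebra.ι K (.ghost e) * FreeAlgebra.ι K (.edge e))
      (FreeAlgebra.ι K (.vertex (E.range e)))
  | ck1_ne (e f : A) : e ≠ f → LeavittRel K E
      (FreeAlgebra.ι K (.ghost e) * FreeAlgebra.ι K (.edge f)) 0
  | ck2 (x : V) : (∃ e, E.source e = x) → LeavittRel K E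
      (FreeAlgebra.ι K (.vertex x))
      (∑ e ∈ Finset.univ.filter (fun e : A => E.source e = x),
        FreeAlgebra.ι K (.edge e) * FreeAlgebra.ι K (.ghost e))

/-- The Leavitt path algebra `L_K(E)` of a finite directed graph `E` over a field `K`. -/
abbrev LeavittPathAlgebra (K : Type w) [Field K] {V : Type u} {A : Type v} [Fintype V] [Fintype A]
    (E : DirGraph V A) : Type (max u v w) :=
  RingQuot (LeavittRel K E)

namespace LeavittPathAlgebra

variable (K : Type w) [Field K] {V : Type u} {A : Type v} [Fintype V] [Fintype A]
  (E : DirGraph V A)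

/-- The image of a generator in `L_K(E)`. -/
noncomputable def gen (g : LeavittGen V A) : LeavittPathAlgebra K E :=
  RingQuot.mkAlgHom K (LeavittRel K E) (FreeAlgebra.ι K g)

/-- The element `x` of `L_K(E)`, for a vertex `x`. -/
noncomputable def vertex (x : V) : LeavittPathAlgebra K E := gen K E (.vertex x)

/-- The element `e` of `L_K(E)`, for an edge `e`. -/
noncomputable def edge (e : A) : LeavittPathAlgebra K E := gen K E (.edge e)

/-- The element `e*` of `L_K(E)`, for an edge `e`. -/
noncomputable def ghost (e : A) : LeavittPathAlgebra K E := gen K E (.ghost e)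

/-- The element of `L_K(E)` given by a path `e₁ … eₙ` with source `x`. It is written `x e₁ … eₙ`, so
that the trivial path at `x` gives `x`. -/
noncomputable def path (x : V) (l : List A) : LeavittPathAlgebra K E :=
  vertex K E x * (l.map (edge K E)).prod

/-- The element `eₙ* … e₁* x` of `L_K(E)`, where `e₁ … eₙ` is a path with source `x`. -/
noncomputable def ghostPath (x : V) (l : List A) : LeavittPathAlgebra K E :=
  (l.reverse.map (ghost K E)).prod * vertex K E x

/-- The homogeneous component of degree `n` for the path-length grading of `L_K(E)`: the span of all
`α β*` where `α`, `β` are paths with the same range and `deg α - deg β = n`. -/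
noncomputable def component (n : ℤ) : Submodule K (LeavittPathAlgebra K E) :=
  Submodule.span K {a | ∃ (x y z : V) (α β : List A), E.IsPath x z α ∧ E.IsPath y z β ∧
    (α.length : ℤ) - (β.length : ℤ) = n ∧ a = path K E x α * ghostPath K E y β}

section Relations

theorem one_eq_sum : (1 : LeavittPathAlgebra K E) = ∑ x : V, vertex K E x := by
  simpa [vertex, gen] using RingQuot.mkAlgHom_rel K (LeavittRel.one (K := K) (E := E))

theorem vertex_mul_self (x : V) : vertex K E x * vertex K E x = vertex K E x := by
  simpa [vertex, gen] using RingQuot.mkAlgHom_rel K (LeavittRel.vertex_mul_self (K := K) (E := E) x)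

theorem vertex_mul_ne {x y : V} (h : x ≠ y) : vertex K E x * vertex K E y = 0 := by
  simpa [vertex, gen] using RingQuot.mkAlgHom_rel K (LeavittRel.vertex_mul_ne (K := K) (E := E) x y h)

theorem source_mul_edge (e : A) : vertex K E (E.source e) * edge K E e = edge K E e := by
  simpa [vertex, edge, gen] using
    RingQuot.mkAlgHom_rel K (LeavittRel.source_mul_edge (K := K) (E := E) e)

theorem edge_mul_range (e : A) : edge K E e * vertex K E (E.range e) = edge K E e := by
  simpa [vertex, edge, gen] using
    RingQuot.mkAlgHom_rel K (LeavittRel.edge_mul_range (K := K) (E := E) e)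

theorem range_mul_ghost (e : A) : vertex K E (E.range e) * ghost K E e = ghost K E e := by
  simpa [vertex, ghost, gen] using
    RingQuot.mkAlgHom_rel K (LeavittRel.range_mul_ghost (K := K) (E := E) e)

theorem ghost_mul_source (e : A) : ghost K E e * vertex K E (E.source e) = ghost K E e := by
  simpa [vertex, ghost, gen] using
    RingQuot.mkAlgHom_rel K (LeavittRel.ghost_mul_source (K := K) (E := E) e)

theorem ck1_self (e : A) : ghost K E e * edge K E e = vertex K E (E.range e) := by
  simpa [vertex, ghost, edge, gen] using
    RingQuot.mkAlgHom_rel K (LeavittRel.ck1_self (K := K) (E := E) e)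

theorem ck1_ne {e f : A} (h : e ≠ f) : ghost K E e * edge K E f = 0 := by
  simpa [ghost, edge, gen] using
    RingQuot.mkAlgHom_rel K (LeavittRel.ck1_ne (K := K) (E := E) e f h)

open Classical in
theorem ck2 (x : V) (h : ∃ e, E.source e = x) :
    vertex K E x = ∑ e ∈ Finset.univ.filter (fun e : A => E.source e = x),
      edge K E e * ghost K E e := by
  simpa [vertex, ghost, edge, gen] using
    RingQuot.mkAlgHom_rel K (LeavittRel.ck2 (K := K) (E := E) x h)

theorem edge_mul_ne {e : A} {x : V} (h : E.range e ≠ x) : edge K E e * vertex K E x = 0 := by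
  rw [← edge_mul_range, mul_assoc, vertex_mul_ne K E h, mul_zero]

theorem ghost_mul_ne {e : A} {x : V} (h : E.source e ≠ x) : ghost K E e * vertex K E x = 0 := by
  rw [← ghost_mul_source, mul_assoc, vertex_mul_ne K E h, mul_zero]

end Relations

/-- The degree of a generator: `0` for vertices, `1` for edges, `-1` for ghost edges. -/
def genDegree : LeavittGen V A → ℤ
  | .vertex _ => 0
  | .edge _ => 1
  | .ghost _ => -1

theorem gen_mul_mem (g : LeavittGen V A) {n : ℤ} {a : LeavittPathAlgebra K E}
    (ha : a ∈ component K E n) : gen K E g * a ∈ component K E (genDegree g + n) := by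
  induction ha using Submodule.span_induction with
  | zero => rw [mul_zero]; exact zero_mem _
  | add a b _ _ iha ihb => rw [mul_add]; exact add_mem iha ihb
  | smul c a _ iha => rw [mul_smul_comm]; exact Submodule.smul_mem _ c iha
  | mem a ha =>
    obtain ⟨x, y, z, α, β, hα, hβ, hn, rfl⟩ := ha
    cases g with
    | vertex t =>
      change vertex K E t * _ ∈ _
      by_cases h : t = x
      · subst h
        refine Submodule.subset_span ⟨t, y, z, α, β, hα, hβ, by simp [genDegree, hn], ?_⟩
        simp only [path, ← mul_assoc, vertex_mul_self]
      · simp only [path, ← mul_assoc, vertex_mul_ne K E h, zero_mul, zero_mem]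
    | edge e =>
      change edge K E e * _ ∈ _
      by_cases h : E.range e = x
      · subst h
        refine Submodule.subset_span ⟨E.source e, y, z, e :: α, β, ⟨rfl, hα⟩, hβ, ?_, ?_⟩
        · simp only [genDegree, List.length_cons, ← hn]; push_cast; ring
        · simp only [path, List.map_cons, List.prod_cons, ← mul_assoc, edge_mul_range,
            source_mul_edge]
      · simp only [path, ← mul_assoc, edge_mul_ne K E h, zero_mul, zero_mem]
    | ghost e =>
      change ghost K E e * _ ∈ _
      by_cases h : E.source e = x
      · subst h
        cases α with
        | nil =>
          have hz : E.source e = z := hα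
          refine Submodule.subset_span
            ⟨E.range e, y, E.range e, [], β ++ [e], rfl, E.isPath_concat hβ hz, ?_, ?_⟩
          · simp only [genDegree, List.length_append, List.length_cons, List.length_nil, ← hn]
            push_cast; ring
          · simp only [path, ghostPath, List.map_nil, List.prod_nil, mul_one, List.reverse_append,
              List.reverse_cons, List.reverse_nil, List.nil_append, List.cons_append,
              List.map_cons, List.prod_cons, ← mul_assoc, ghost_mul_source, range_mul_ghost]
        | cons f α =>
          by_cases hf : e = f
          · subst hf
            refine Submodule.subset_span ⟨E.range e, y, z, α, β, hα.2, hβ, ?_, ?_⟩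
            · simp only [genDegree, ← hn, List.length_cons]; push_cast; ring
            · simp only [path, List.map_cons, List.prod_cons, ← mul_assoc, ghost_mul_source,
                ck1_self]
          · simp only [path, List.map_cons, List.prod_cons, ← mul_assoc, ghost_mul_source,
              ck1_ne K E hf, zero_mul, zero_mem]
      · simp only [path, ← mul_assoc, ghost_mul_ne K E h, zero_mul, zero_mem]

theorem prod_edge_mul_mem (l : List A) {n : ℤ} {a : LeavittPathAlgebra K E}
    (ha : a ∈ component K E n) :
    (l.map (edge K E)).prod * a ∈ component K E (l.length + n) := by
  induction l with
  | nil => simpa using ha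
  | cons e l ih =>
    have := gen_mul_mem K E (.edge e) ih
    simp only [List.map_cons, List.prod_cons, mul_assoc, List.length_cons]
    refine (congrArg (fun n => _ ∈ component K E n) ?_).mp this
    simp only [genDegree]; push_cast; ring

theorem prod_ghost_mul_mem (l : List A) {n : ℤ} {a : LeavittPathAlgebra K E}
    (ha : a ∈ component K E n) :
    (l.map (ghost K E)).prod * a ∈ component K E (-l.length + n) := by
  induction l with
  | nil => simpa using ha
  | cons e l ih =>
    have := gen_mul_mem K E (.ghost e) ih
    simp only [List.map_cons, List.prod_cons, mul_assoc, List.length_cons]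
    refine (congrArg (fun n => _ ∈ component K E n) ?_).mp this
    simp only [genDegree]; push_cast; ring

instance gradedMonoid : SetLike.GradedMonoid (component K E) where
  one_mem := by
    rw [one_eq_sum]
    refine sum_mem fun x _ => Submodule.subset_span ⟨x, x, x, [], [], rfl, rfl, by simp, ?_⟩
    simp [path, ghostPath, vertex_mul_self]
  mul_mem := by
    intro m n a b ha hb
    induction ha using Submodule.span_induction with
    | zero => rw [zero_mul]; exact zero_mem _
    | add a b _ _ iha ihb => rw [add_mul]; exact add_mem iha ihb
    | smul c a _ iha => rw [smul_mul_assoc]; exact Submodule.smul_mem _ c iha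
    | mem a ha =>
      obtain ⟨x, y, z, α, β, -, -, rfl, rfl⟩ := ha
      have h1 := gen_mul_mem K E (.vertex y) hb
      have h2 := prod_ghost_mul_mem K E β.reverse h1
      have h3 := prod_edge_mul_mem K E α h2
      have h4 := gen_mul_mem K E (.vertex x) h3
      simp only [path, ghostPath, mul_assoc]
      refine (congrArg (fun n => _ ∈ component K E n) ?_).mp h4
      simp only [genDegree, List.length_reverse]; ring

theorem gen_mem (g : LeavittGen V A) : gen K E g ∈ component K E (genDegree g) := by
  simpa using gen_mul_mem K E g (SetLike.GradedOne.one_mem (A := component K E))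

open DirectSum

/-- A generator, as an element of the direct sum of the homogeneous components. -/
noncomputable def genDecomp (g : LeavittGen V A) : ⨁ n, component K E n :=
  DirectSum.of (fun n => component K E n) (genDegree g) ⟨gen K E g, gen_mem K E g⟩

theorem of_eq {m n : ℤ} {a b : LeavittPathAlgebra K E} (ha : a ∈ component K E m)
    (hb : b ∈ component K E n) (hmn : m = n) (hab : a = b) :
    DirectSum.of (fun n => component K E n) m ⟨a, ha⟩ = DirectSum.of _ n ⟨b, hb⟩ := by
  subst hmn; subst hab; rfl

theorem genDecomp_mul_eq {g h k : LeavittGen V A}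
    (hd : genDegree g + genDegree h = genDegree k) (he : gen K E g * gen K E h = gen K E k) :
    genDecomp K E g * genDecomp K E h = genDecomp K E k := by
  rw [genDecomp, genDecomp, DirectSum.of_mul_of]
  exact of_eq K E _ _ hd he

theorem genDecomp_mul_zero {g h : LeavittGen V A} (he : gen K E g * gen K E h = 0) :
    genDecomp K E g * genDecomp K E h = 0 := by
  rw [genDecomp, genDecomp, DirectSum.of_mul_of]
  exact (of_eq K E _ (zero_mem _) rfl he).trans (map_zero _)

theorem genDecomp_mul_of {g h : LeavittGen V A} {n : ℤ} (hd : genDegree g + genDegree h = n)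
    (hm : gen K E g * gen K E h ∈ component K E n) :
    genDecomp K E g * genDecomp K E h = DirectSum.of (fun n => component K E n) n
      ⟨gen K E g * gen K E h, hm⟩ := by
  rw [genDecomp, genDecomp, DirectSum.of_mul_of]
  exact of_eq K E _ _ hd rfl

open Classical in
theorem lift_genDecomp_rel ⦃a b : FreeAlgebra K (LeavittGen V A)⦄ (h : LeavittRel K E a b) :
    FreeAlgebra.lift K (genDecomp K E) a = FreeAlgebra.lift K (genDecomp K E) b := by
  induction h with
  | one =>
    simp only [map_one, map_sum, FreeAlgebra.lift_ι_apply]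
    have h0 : ∀ x : V, genDecomp K E (.vertex x) = DirectSum.of (fun n => component K E n) 0
      ⟨vertex K E x, gen_mem K E (.vertex x)⟩ := fun x => rfl
    simp only [h0, ← map_sum]
    rw [DirectSum.one_def]
    congr 1
    ext
    simp [one_eq_sum]
  | vertex_mul_self x =>
    simp only [map_mul, FreeAlgebra.lift_ι_apply]
    exact genDecomp_mul_eq K E (by simp [genDegree]) (vertex_mul_self K E x)
  | vertex_mul_ne x y h =>
    simp only [map_mul, map_zero, FreeAlgebra.lift_ι_apply]
    exact genDecomp_mul_zero K E (vertex_mul_ne K E h)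
  | source_mul_edge e =>
    simp only [map_mul, FreeAlgebra.lift_ι_apply]
    exact genDecomp_mul_eq K E (by simp [genDegree]) (source_mul_edge K E e)
  | edge_mul_range e =>
    simp only [map_mul, FreeAlgebra.lift_ι_apply]
    exact genDecomp_mul_eq K E (by simp [genDegree]) (edge_mul_range K E e)
  | range_mul_ghost e =>
    simp only [map_mul, FreeAlgebra.lift_ι_apply]
    exact genDecomp_mul_eq K E (by simp [genDegree]) (range_mul_ghost K E e)
  | ghost_mul_source e =>
    simp only [map_mul, FreeAlgebra.lift_ι_apply]
    exact genDecomp_mul_eq K E (by simp [genDegree]) (ghost_mul_source K E e)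
  | ck1_self e =>
    simp only [map_mul, FreeAlgebra.lift_ι_apply]
    exact genDecomp_mul_eq K E (by simp [genDegree]) (ck1_self K E e)
  | ck1_ne e f h =>
    simp only [map_mul, map_zero, FreeAlgebra.lift_ι_apply]
    exact genDecomp_mul_zero K E (ck1_ne K E h)
  | ck2 x h =>
    simp only [map_mul, map_sum, FreeAlgebra.lift_ι_apply]
    have hm : ∀ e : A, edge K E e * ghost K E e ∈ component K E 0 := fun e => by
      have h1 := gen_mul_mem K E (.edge e) (gen_mem K E (.ghost e))
      rwa [show genDegree (.edge e : LeavittGen V A) + genDegree (.ghost e) = 0 from rfl] at h1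
    have h0 : ∀ e : A, genDecomp K E (.edge e) * genDecomp K E (.ghost e) =
        DirectSum.of (fun n => component K E n) 0 ⟨edge K E e * ghost K E e, hm e⟩ :=
      fun e => genDecomp_mul_of K E (by simp [genDegree]) (hm e)
    simp only [h0, ← map_sum]
    have h1 : genDecomp K E (.vertex x) = DirectSum.of (fun n => component K E n) 0
      ⟨vertex K E x, gen_mem K E (.vertex x)⟩ := rfl
    rw [h1]
    congr 1
    ext
    rw [AddSubmonoidClass.coe_finsetSum]
    exact ck2 K E x h

/-- The decomposition into homogeneous components, as an algebra homomorphism. -/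
noncomputable def decompHom : LeavittPathAlgebra K E →ₐ[K] ⨁ n, component K E n :=
  RingQuot.liftAlgHom K ⟨FreeAlgebra.lift K (genDecomp K E), lift_genDecomp_rel K E⟩

theorem decompHom_gen (g : LeavittGen V A) : decompHom K E (gen K E g) = genDecomp K E g := by
  simp [decompHom, gen]

theorem decompHom_mul {m n : ℤ} {a b : LeavittPathAlgebra K E}
    (ha : ∃ h : a ∈ component K E m, decompHom K E a = DirectSum.of _ m ⟨a, h⟩)
    (hb : ∃ h : b ∈ component K E n, decompHom K E b = DirectSum.of _ n ⟨b, h⟩) :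
    ∃ h : a * b ∈ component K E (m + n),
      decompHom K E (a * b) = DirectSum.of _ (m + n) ⟨a * b, h⟩ := by
  obtain ⟨ha, ha'⟩ := ha
  obtain ⟨hb, hb'⟩ := hb
  refine ⟨SetLike.GradedMul.mul_mem ha hb, ?_⟩
  rw [map_mul, ha', hb', DirectSum.of_mul_of]
  rfl

theorem decompHom_prod (d : ℤ) (f : A → LeavittPathAlgebra K E)
    (hf : ∀ e, ∃ h : f e ∈ component K E d, decompHom K E (f e) = DirectSum.of _ d ⟨f e, h⟩)
    (l : List A) : ∃ h : (l.map f).prod ∈ component K E (l.length * d),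
      decompHom K E (l.map f).prod = DirectSum.of _ (l.length * d) ⟨(l.map f).prod, h⟩ := by
  induction l with
  | nil =>
    have h1 : (1 : LeavittPathAlgebra K E) ∈ component K E 0 := SetLike.GradedOne.one_mem
    refine ⟨by simpa using h1, ?_⟩
    simp only [List.map_nil, List.prod_nil, map_one]
    exact of_eq K E h1 _ (by simp) rfl
  | cons e l ih =>
    obtain ⟨h, h'⟩ := decompHom_mul K E (hf e) ih
    have hd : d + (l.length : ℤ) * d = ((e :: l).length : ℤ) * d := by
      simp only [List.length_cons]; push_cast; ring
    refine ⟨by simpa only [List.map_cons, List.prod_cons, ← hd] using h, ?_⟩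
    simp only [List.map_cons, List.prod_cons]
    exact h'.trans (of_eq K E _ _ hd rfl)

/-- The path-length grading of `L_K(E)`. -/
noncomputable instance gradedAlgebra : GradedAlgebra (component K E) :=
  GradedAlgebra.ofAlgHom (component K E) (decompHom K E)
    (by
      apply RingQuot.ringQuot_ext'
      apply FreeAlgebra.hom_ext
      funext g
      change DirectSum.coeAlgHom (component K E) (decompHom K E (gen K E g)) = gen K E g
      rw [decompHom_gen, genDecomp, DirectSum.coeAlgHom_of])
    (by
      rintro n ⟨a, ha⟩
      change decompHom K E a = _
      induction ha using Submodule.span_induction with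
      | zero => rw [map_zero]; exact (map_zero _).symm
      | add a b _ _ iha ihb => rw [map_add, iha, ihb, ← map_add]; rfl
      | smul c a ha iha =>
        rw [map_smul, iha]
        exact ((DirectSum.lof K ℤ (fun n => component K E n) n).map_smul c ⟨a, ha⟩).symm
      | mem a ha =>
        obtain ⟨x, y, z, α, β, -, -, rfl, rfl⟩ := ha
        have hg : ∀ g : LeavittGen V A, ∃ h : gen K E g ∈ component K E (genDegree g),
            decompHom K E (gen K E g) = DirectSum.of _ (genDegree g) ⟨gen K E g, h⟩ :=
          fun g => ⟨gen_mem K E g, decompHom_gen K E g⟩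
        obtain ⟨h, h'⟩ := decompHom_mul K E
          (decompHom_mul K E (hg (.vertex x)) (decompHom_prod K E 1 _ (fun e => hg (.edge e)) α))
          (decompHom_mul K E (decompHom_prod K E (-1) _ (fun e => hg (.ghost e)) β.reverse)
            (hg (.vertex y)))
        refine h'.trans (of_eq K E _ _ ?_ rfl)
        simp only [genDegree, List.length_reverse]; ring)

/-- A two-sided ideal is graded if it contains all homogeneous components of each of its elements,
with respect to the path-length grading. -/
def IsGradedIdeal (I : TwoSidedIdeal (LeavittPathAlgebra K E)) : Prop :=
  SetLike.IsHomogeneous (component K E) I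

end LeavittPathAlgebra

/-! Sufficiency of (K). Every ideal `I` is generated by the vertices it contains
(`eq_span_vertices`); vertices have degree 0, so `I` is graded. Let `J` be the ideal generated by
the vertices of `I`, and suppose `a ∈ I` lies outside `J`. By (CK2), right multiplication by
suitable edges removes all ghost edges from `a` without entering `J`. Cut off at a target `y` and
multiplied on the left by the ghost of a shortest path occurring in it, the element becomes `c y +
t` in `I`, with `c ≠ 0` and `t` a combination of nontrivial closed paths at `y`. If no closed simple
path is based at `y`, then `t = 0`. If `p ≠ q` are two of them, compression by `γ = pⁿq` fixes `y`,
and it kills `t` for large `n`, because `γ` is not a prefix of `mγ` for a nontrivial closed path `m`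
with at most `n` edges. Either way `y ∈ I`, hence `y ∈ J`, a contradiction.

Necessity of (K). Let `λ` be the only closed simple path at `x`. If the ideal generated by `x + λ`
were graded, it would contain `x`, the degree-0 component of the generator. But `L_K(E)` acts on
functions on the infinite paths that meet `x` infinitely often, with signs chosen so that `λ` has
total sign `-1`. The only such path starting at `x` is `λλλ…`, so `x + λ` acts as zero while `x`
does not (`not_isGradedIdeal_span_vertex_add_path`). No assumption on the field enters. -/

namespace DirGraph

/-! ### Closed paths and the prefix code of closed simple paths -/

variable {V : Type u} {A : Type v} {E : DirGraph V A}

theorem IsPath.append {x y z : V} {l m : List A} (hl : E.IsPath x y l) (hm : E.IsPath y z m) :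
    E.IsPath x z (l ++ m) := by
  induction l generalizing x with
  | nil =>
    have h : x = y := hl
    exact h ▸ hm
  | cons e l ih => exact ⟨hl.1, ih hl.2⟩

theorem IsPath.exists_of_append {x z : V} {l m : List A} (h : E.IsPath x z (l ++ m)) :
    ∃ y, E.IsPath x y l ∧ E.IsPath y z m := by
  induction l generalizing x with
  | nil => exact ⟨x, rfl, h⟩
  | cons e l ih =>
    obtain ⟨y, h1, h2⟩ := ih h.2
    exact ⟨y, ⟨h.1, h1⟩, h2⟩

theorem IsPath.range_unique {x y z : V} {l : List A} (hy : E.IsPath x y l)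
    (hz : E.IsPath x z l) : y = z := by
  induction l generalizing x with
  | nil =>
    have h1 : x = y := hy
    have h2 : x = z := hz
    exact h1 ▸ h2
  | cons e l ih => exact ih hy.2 hz.2

/-- The first return of a path to its target `y` splits off a shortest initial path ending there. -/
theorem IsPath.exists_first_visit {x y : V} {l : List A} (h : E.IsPath x y l) :
    ∃ m n, l = m ++ n ∧ E.IsPath x y m ∧ E.IsPath y y n ∧ ∀ e ∈ m, E.source e ≠ y := by
  induction l generalizing x with
  | nil => exact ⟨[], [], rfl, h, rfl, by simp⟩
  | cons e l ih =>
    by_cases hx : x = y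
    · subst hx
      exact ⟨[], e :: l, rfl, rfl, h, by simp⟩
    · obtain ⟨m, n, rfl, hm, hn, hmn⟩ := ih h.2
      refine ⟨e :: m, n, rfl, ⟨h.1, hm⟩, hn, ?_⟩
      simpa [h.1, hx] using hmn

/-- A nontrivial closed path starts with a closed simple path. -/
theorem IsPath.exists_closedSimple_append {x : V} {l : List A} (h : E.IsPath x x l)
    (hl : l ≠ []) : ∃ c m, l = c ++ m ∧ E.IsClosedSimplePath x c ∧ E.IsPath x x m := by
  cases l with
  | nil => exact absurd rfl hl
  | cons e l =>
    obtain ⟨m, n, rfl, hm, hn, hmn⟩ := h.2.exists_first_visit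
    exact ⟨e :: m, n, rfl, ⟨by simp, ⟨h.1, hm⟩, hmn⟩, hn⟩

/-- An edge of `d` just after the prefix `c` would leave from `x`, which simplicity of `d` forbids.
Thus the closed simple paths at `x` form a prefix code. -/
theorem IsClosedSimplePath.eq_of_prefix {x : V} {c d : List A} (hc : E.IsClosedSimplePath x c)
    (hd : E.IsClosedSimplePath x d) (h : c <+: d) : c = d := by
  obtain ⟨m, rfl⟩ := h
  cases m with
  | nil => simp
  | cons e m =>
    exfalso
    obtain ⟨y, h1, h2⟩ := hd.2.1.exists_of_append
    obtain rfl := hc.2.1.range_unique h1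
    refine hd.2.2 e ?_ h2.1
    rw [List.tail_append_of_ne_nil hc.1]
    simp

theorem IsClosedSimplePath.eq_of_prefix_of_prefix {x : V} {c d l : List A}
    (hc : E.IsClosedSimplePath x c) (hd : E.IsClosedSimplePath x d) (h : c <+: l) (h' : d <+: l) :
    c = d := by
  rcases List.prefix_or_prefix_of_prefix h h' with h | h
  · exact hc.eq_of_prefix hd h
  · exact (hd.eq_of_prefix hc h).symm

/-- The path `c … c d`, with `n` copies of `c`. -/
def powAppend (c d : List A) : ℕ → List A
  | 0 => d
  | n + 1 => c ++ powAppend c d n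

theorem isPath_powAppend {x : V} {c d : List A} (hc : E.IsPath x x c) (hd : E.IsPath x x d)
    (n : ℕ) : E.IsPath x x (powAppend c d n) := by
  induction n with
  | zero => exact hd
  | succ n ih => exact hc.append ih

/-- By the prefix code property, `m` can only begin with `c`, and copies of `c` can be peeled off
both sides. The bound on `m.length` ensures that `m` is used up before the left side is down to `d`;
the right side then still starts with `c`, which forces `c = d`. The case needed later is `n = k`
with `m ≠ []`; the alternative `n < k` is what the induction passes on. -/
theorem not_powAppend_prefix {x : V} {c d : List A} (hc : E.IsClosedSimplePath x c)
    (hd : E.IsClosedSimplePath x d) (hcd : c ≠ d) {n k : ℕ} {m : List A} (hm : E.IsPath x x m)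
    (hmn : m.length ≤ n) (hnk : n ≤ k) (h : m ≠ [] ∨ n < k) :
    ¬ powAppend c d n <+: m ++ powAppend c d k := by
  intro hp
  induction n generalizing m k with
  | zero =>
    obtain rfl : m = [] := List.length_eq_zero_iff.mp (by omega)
    have hk : 0 < k := by simpa using h
    obtain ⟨k, rfl⟩ := Nat.exists_eq_add_of_lt hk
    refine hcd (hc.eq_of_prefix_of_prefix hd (l := powAppend c d (0 + k + 1)) ?_ hp)
    exact List.prefix_append _ _
  | succ n ih =>
    have hpc : c <+: m ++ powAppend c d k := (List.prefix_append _ _).trans hp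
    by_cases hm0 : m = []
    · subst hm0
      have hk : n + 1 < k := by simpa using h
      obtain ⟨k, rfl⟩ : ∃ j, k = j + 1 := ⟨k - 1, by omega⟩
      refine ih (k := k) hm (by simp) (by omega) (Or.inr (by omega)) ?_
      simpa only [powAppend, List.nil_append, List.prefix_append_right_inj] using hp
    · obtain ⟨c', m', rfl, hc', hm'⟩ := hm.exists_closedSimple_append hm0
      have hcc : c = c' := hc.eq_of_prefix_of_prefix hc' hpc
        (by rw [List.append_assoc]; exact List.prefix_append _ _)
      subst hcc
      have := List.length_pos_iff.mpr hc.1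
      rw [List.length_append] at hmn
      -- The copy of `c` on the right came from `m`, so `k` is unchanged while the left exponent
      -- dropped: strict inequality holds from here on.
      refine ih (k := k) hm' (by omega) (by omega) (Or.inr (by omega)) ?_
      simpa only [powAppend, List.append_assoc, List.prefix_append_right_inj] using hp

end DirGraph

namespace LeavittPathAlgebra

open DirGraph

/-! ### Ideals generated by homogeneous elements -/

section Ideals

variable (K : Type w) [Field K] {V : Type u} {A : Type v} [Fintype V] [Fintype A]
  (E : DirGraph V A)

theorem isHomogeneous_span_of_isHomogeneousElem {s : Set (LeavittPathAlgebra K E)}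
    (hs : ∀ a ∈ s, SetLike.IsHomogeneousElem (component K E) a) :
    IsGradedIdeal K E (TwoSidedIdeal.span s) := by
  -- A product of homogeneous elements is homogeneous, so its components are itself and zeros. The
  -- absorption cases reduce to this by expanding both factors into components.
  have key : ∀ {a b : LeavittPathAlgebra K E} {i j : ℤ} (n : ℤ), a ∈ component K E i →
      b ∈ component K E j → a * b ∈ TwoSidedIdeal.span s →
      (DirectSum.decompose (component K E) (a * b) n : LeavittPathAlgebra K E) ∈
        TwoSidedIdeal.span s := by
    intro a b i j n ha hb hab
    have hm : a * b ∈ component K E (i + j) := SetLike.GradedMul.mul_mem ha hb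
    by_cases h : i + j = n
    · subst h
      rwa [DirectSum.decompose_of_mem_same _ hm]
    · rw [DirectSum.decompose_of_mem_ne _ hm h]
      exact zero_mem _
  intro n a ha
  revert n
  induction ha using TwoSidedIdeal.span_induction with
  | mem a h =>
    intro n
    obtain ⟨i, hi⟩ := hs a h
    simpa using key n SetLike.GradedOne.one_mem hi
      (by simpa using TwoSidedIdeal.subset_span h)
  | zero => intro n; simp [zero_mem]
  | add a b _ _ iha ihb =>
    intro n
    rw [DirectSum.decompose_add, DirectSum.add_apply]
    exact add_mem (iha n) (ihb n)
  | neg a _ iha =>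
    intro n
    have h : (DirectSum.decompose (component K E) (-a) n : LeavittPathAlgebra K E) =
        -(DirectSum.decompose (component K E) a n : LeavittPathAlgebra K E) := by
      rw [DirectSum.decompose_neg]; rfl
    rw [h]
    exact neg_mem (iha n)
  | left_absorb b a _ iha =>
    intro n
    classical
    rw [← DirectSum.sum_support_decompose (component K E) b,
      ← DirectSum.sum_support_decompose (component K E) a, Finset.sum_mul_sum]
    simp only [← GradedRing.proj_apply, map_sum]
    exact sum_mem fun i _ => sum_mem fun j _ => key n (SetLike.coe_mem _) (SetLike.coe_mem _)
      (TwoSidedIdeal.mul_mem_left _ _ _ (iha j))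
  | right_absorb b a _ iha =>
    intro n
    classical
    rw [← DirectSum.sum_support_decompose (component K E) b,
      ← DirectSum.sum_support_decompose (component K E) a, Finset.sum_mul_sum]
    simp only [← GradedRing.proj_apply, map_sum]
    exact sum_mem fun i _ => sum_mem fun j _ => key n (SetLike.coe_mem _) (SetLike.coe_mem _)
      (TwoSidedIdeal.mul_mem_right _ _ _ (iha i))

variable {K E}

theorem smul_mem_ideal (I : TwoSidedIdeal (LeavittPathAlgebra K E)) (c : K)
    {a : LeavittPathAlgebra K E} (ha : a ∈ I) : c • a ∈ I := by
  rw [← one_mul a, ← smul_mul_assoc]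
  exact I.mul_mem_left _ _ ha

theorem mem_of_smul_mem_ideal (I : TwoSidedIdeal (LeavittPathAlgebra K E)) {c : K} (hc : c ≠ 0)
    {a : LeavittPathAlgebra K E} (ha : c • a ∈ I) : a ∈ I := by
  simpa [smul_smul, hc] using smul_mem_ideal I c⁻¹ ha

end Ideals

/-! ### Under Condition (K) ideals are generated by vertices -/

section Reduction

variable (K : Type w) [Field K] {V : Type u} {A : Type v} [Fintype V] [Fintype A]
  (E : DirGraph V A)

/-- The product of the edges of a path, cut off at the target vertex. -/
noncomputable def pathTo (y : V) (l : List A) : LeavittPathAlgebra K E :=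
  (l.map (edge K E)).prod * vertex K E y

/-- The product `eₙ* … e₁*` of the ghost edges of a list of edges `e₁, …, eₙ`. -/
noncomputable def ghostProd (l : List A) : LeavittPathAlgebra K E :=
  (l.reverse.map (ghost K E)).prod

/-- The span of the `αβ*` where `β` has length at most `n`. -/
noncomputable def ghostFiltration (n : ℕ) : Submodule K (LeavittPathAlgebra K E) :=
  Submodule.span K {a | ∃ (x y z : V) (α β : List A), E.IsPath x z α ∧ E.IsPath y z β ∧
    β.length ≤ n ∧ a = path K E x α * ghostPath K E y β}

variable {K E}

theorem pathTo_cons (y : V) (e : A) (l : List A) :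
    pathTo K E y (e :: l) = edge K E e * pathTo K E y l := by
  simp [pathTo, mul_assoc]

theorem pathTo_append (y : V) (l m : List A) :
    pathTo K E y (l ++ m) = (l.map (edge K E)).prod * pathTo K E y m := by
  simp [pathTo, mul_assoc]

theorem ghostProd_cons (e : A) (l : List A) :
    ghostProd K E (e :: l) = ghostProd K E l * ghost K E e := by
  simp [ghostProd]

theorem vertex_mul_pathTo {x y : V} {l : List A} (h : E.IsPath x y l) :
    vertex K E x * pathTo K E y l = pathTo K E y l := by
  cases l with
  | nil =>
    have h : x = y := h
    simp [pathTo, h, vertex_mul_self]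
  | cons e l =>
    rw [pathTo_cons, ← mul_assoc, ← h.1, source_mul_edge]

theorem path_eq_pathTo {x y : V} {l : List A} (h : E.IsPath x y l) :
    path K E x l = pathTo K E y l := by
  rw [← vertex_mul_pathTo h]
  induction l generalizing x with
  | nil =>
    have h : x = y := h
    simp [path, pathTo, h, vertex_mul_self]
  | cons e l ih =>
    have := ih h.2
    rw [vertex_mul_pathTo h.2] at this
    rw [pathTo_cons, ← this, path, path, ← mul_assoc (edge K E e), edge_mul_range]
    simp

theorem ghostProd_mul_pathTo_append {x y : V} {l m : List A} (h : E.IsPath x y (l ++ m)) :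
    ghostProd K E l * pathTo K E y (l ++ m) = pathTo K E y m := by
  induction l generalizing x with
  | nil => simp [ghostProd]
  | cons e l ih =>
    have h2 : E.IsPath (E.range e) y (l ++ m) := h.2
    rw [List.cons_append, pathTo_cons, ghostProd_cons, mul_assoc, ← mul_assoc (ghost K E e),
      ck1_self, vertex_mul_pathTo h2, ih h2]

/-- Cancelling edges from the left meets a mismatch, where (CK1) gives zero. The length bound
excludes that `m` is a proper prefix of `l`, when a ghost path would survive. -/
theorem ghostProd_mul_pathTo_eq_zero {x y : V} {l m : List A} (h : E.IsPath x y m)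
    (hl : l.length ≤ m.length) (hlm : ¬ l <+: m) : ghostProd K E l * pathTo K E y m = 0 := by
  induction l generalizing x m with
  | nil => exact absurd (List.nil_prefix) hlm
  | cons e l ih =>
    cases m with
    | nil => simp at hl
    | cons f m =>
      rw [pathTo_cons, ghostProd_cons, mul_assoc, ← mul_assoc (ghost K E e)]
      by_cases hef : e = f
      · subst hef
        rw [ck1_self, vertex_mul_pathTo h.2]
        exact ih h.2 (by simpa using hl) (by simpa using hlm)
      · rw [ck1_ne K E hef, zero_mul, mul_zero]

theorem ghostFiltration_mono : Monotone (ghostFiltration K E) := by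
  intro m n hmn
  refine Submodule.span_mono ?_
  rintro a ⟨x, y, z, α, β, hα, hβ, hn, rfl⟩
  exact ⟨x, y, z, α, β, hα, hβ, hn.trans hmn, rfl⟩

theorem exists_mem_ghostFiltration (a : LeavittPathAlgebra K E) :
    ∃ n, a ∈ ghostFiltration K E n := by
  have hadd : ∀ a b : LeavittPathAlgebra K E, (∃ n, a ∈ ghostFiltration K E n) →
      (∃ n, b ∈ ghostFiltration K E n) → ∃ n, a + b ∈ ghostFiltration K E n := by
    rintro a b ⟨m, hm⟩ ⟨n, hn⟩
    exact ⟨max m n, add_mem (ghostFiltration_mono (le_max_left _ _) hm)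
      (ghostFiltration_mono (le_max_right _ _) hn)⟩
  classical
  rw [← DirectSum.sum_support_decompose (component K E) a]
  refine Finset.sum_induction _ (fun a => ∃ n, a ∈ ghostFiltration K E n) hadd
    ⟨0, zero_mem _⟩ fun i _ => ?_
  have hi : (DirectSum.decompose (component K E) a i : LeavittPathAlgebra K E) ∈
    component K E i := SetLike.coe_mem _
  generalize (DirectSum.decompose (component K E) a i : LeavittPathAlgebra K E) = b at hi
  induction hi using Submodule.span_induction with
  | zero => exact ⟨0, zero_mem _⟩
  | add a b _ _ iha ihb => exact hadd a b iha ihb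
  | smul c a _ iha =>
    obtain ⟨n, hn⟩ := iha
    exact ⟨n, Submodule.smul_mem _ c hn⟩
  | mem a ha =>
    obtain ⟨x, y, z, α, β, hα, hβ, -, rfl⟩ := ha
    exact ⟨β.length, Submodule.subset_span ⟨x, y, z, α, β, hα, hβ, le_rfl, rfl⟩⟩

/-- The first edge of `β` is the last ghost in `β*`, so a right factor `e` cancels it or gives zero;
for trivial `β` it extends `α` instead or gives zero. -/
theorem mul_edge_mem_ghostFiltration {n : ℕ} {a : LeavittPathAlgebra K E}
    (ha : a ∈ ghostFiltration K E (n + 1)) (e : A) : a * edge K E e ∈ ghostFiltration K E n := by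
  induction ha using Submodule.span_induction with
  | zero => rw [zero_mul]; exact zero_mem _
  | add a b _ _ iha ihb => rw [add_mul]; exact add_mem iha ihb
  | smul c a _ iha => rw [smul_mul_assoc]; exact Submodule.smul_mem _ c iha
  | mem a ha =>
    obtain ⟨x, y, z, α, β, hα, hβ, hn, rfl⟩ := ha
    cases β with
    | nil =>
      obtain rfl : y = z := hβ
      by_cases hy : E.source e = y
      · subst hy
        refine Submodule.subset_span ⟨x, E.range e, E.range e, α ++ [e], [],
          E.isPath_concat hα rfl, rfl, by simp, ?_⟩
        simp [path, ghostPath, mul_assoc, source_mul_edge, edge_mul_range]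
      · have h0 : vertex K E y * edge K E e = 0 := by
          rw [← source_mul_edge, ← mul_assoc, vertex_mul_ne K E (Ne.symm hy), zero_mul]
        simp [ghostPath, mul_assoc, h0, zero_mem]
    | cons f β =>
      have hgf : ghost K E f * vertex K E y = ghost K E f := by
        rw [← hβ.1, ghost_mul_source]
      by_cases hf : f = e
      · subst hf
        refine Submodule.subset_span ⟨x, E.range f, z, α, β, hα, hβ.2, by simpa using hn, ?_⟩
        simp only [ghostPath, List.reverse_cons, List.map_append, List.prod_append, List.map_cons,
          List.map_nil, List.prod_cons, List.prod_nil, mul_one, mul_assoc]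
        rw [← mul_assoc (ghost K E f), hgf, ck1_self]
      · simp only [ghostPath, List.reverse_cons, List.map_append, List.prod_append, List.map_cons,
          List.map_nil, List.prod_cons, List.prod_nil, mul_one, mul_assoc]
        rw [← mul_assoc (ghost K E f), hgf, ck1_ne K E hf]
        simp [zero_mem]

theorem mul_vertex_mem_ghostFiltration_zero {n : ℕ} {a : LeavittPathAlgebra K E}
    (ha : a ∈ ghostFiltration K E n) {t : V} (ht : ∀ e, E.source e ≠ t) :
    a * vertex K E t ∈ ghostFiltration K E 0 := by
  induction ha using Submodule.span_induction with
  | zero => rw [zero_mul]; exact zero_mem _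
  | add a b _ _ iha ihb => rw [add_mul]; exact add_mem iha ihb
  | smul c a _ iha => rw [smul_mul_assoc]; exact Submodule.smul_mem _ c iha
  | mem a ha =>
    obtain ⟨x, y, z, α, β, hα, hβ, hn, rfl⟩ := ha
    by_cases hy : y = t
    · subst hy
      cases β with
      | nil =>
        refine Submodule.subset_span ⟨x, y, z, α, [], hα, hβ, le_rfl, ?_⟩
        simp [ghostPath, mul_assoc, vertex_mul_self]
      | cons f β => exact absurd hβ.1 (ht f)
    · simp [ghostPath, mul_assoc, vertex_mul_ne K E hy, zero_mem]

/-- Outside a two-sided ideal, every element has a right multiple, still outside, that is a linear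
combination of real paths. -/
theorem exists_mul_mem_ghostFiltration_zero (J : TwoSidedIdeal (LeavittPathAlgebra K E))
    {n : ℕ} {a : LeavittPathAlgebra K E} (ha : a ∈ ghostFiltration K E n) (haJ : a ∉ J) :
    ∃ b, a * b ∉ J ∧ a * b ∈ ghostFiltration K E 0 := by
  induction n generalizing a with
  | zero => exact ⟨1, by simpa using haJ, by simpa using ha⟩
  | succ n ih =>
    obtain ⟨t, ht⟩ : ∃ t, a * vertex K E t ∉ J := by
      by_contra! h
      apply haJ
      rw [← mul_one a, one_eq_sum, Finset.mul_sum]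
      exact sum_mem fun t _ => h t
    by_cases hs : ∃ e, E.source e = t
    · obtain ⟨e, he⟩ : ∃ e, a * edge K E e ∉ J := by
        by_contra! h
        apply ht
        classical
        rw [ck2 K E t hs, Finset.mul_sum]
        exact sum_mem fun e _ => by
          rw [← mul_assoc]
          exact J.mul_mem_right _ _ (h e)
      obtain ⟨b, hb, hb'⟩ := ih (mul_edge_mem_ghostFiltration ha e) he
      exact ⟨edge K E e * b, by rwa [← mul_assoc], by rwa [← mul_assoc]⟩
    · push Not at hs
      exact ⟨vertex K E t, ht, mul_vertex_mem_ghostFiltration_zero ha hs⟩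

/-- With the target `y` fixed, the list of edges alone determines the path, the trivial one
included; lists can then serve as indices of a linear combination. -/
theorem mul_vertex_mem_span_pathTo {a : LeavittPathAlgebra K E}
    (ha : a ∈ ghostFiltration K E 0) (y : V) :
    a * vertex K E y ∈ Submodule.span K (pathTo K E y '' {l | ∃ x, E.IsPath x y l}) := by
  induction ha using Submodule.span_induction with
  | zero => rw [zero_mul]; exact zero_mem _
  | add a b _ _ iha ihb => rw [add_mul]; exact add_mem iha ihb
  | smul c a _ iha => rw [smul_mul_assoc]; exact Submodule.smul_mem _ c iha
  | mem a ha =>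
    obtain ⟨x, t, z, α, β, hα, hβ, hn, rfl⟩ := ha
    obtain rfl : β = [] := List.length_eq_zero_iff.mp (by omega)
    obtain rfl : t = z := hβ
    by_cases hy : t = y
    · subst hy
      refine Submodule.subset_span ⟨α, ⟨x, hα⟩, ?_⟩
      simp [ghostPath, mul_assoc, vertex_mul_self, path_eq_pathTo hα, pathTo]
    · simp [ghostPath, mul_assoc, vertex_mul_ne K E hy, zero_mem]

/-- Multiplying a nonzero combination of paths ending at `y` by the ghost of a shortest one gives
a nonzero multiple of `y` plus a combination of nontrivial closed paths at `y`. -/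
theorem exists_ghostProd_mul_eq {y : V} {a : LeavittPathAlgebra K E} (ha0 : a ≠ 0)
    (ha : a ∈ Submodule.span K (pathTo K E y '' {l | ∃ x, E.IsPath x y l})) :
    ∃ (l : List A) (c : K), c ≠ 0 ∧ ∃ t ∈ Submodule.span K
      (pathTo K E y '' {m | m ≠ [] ∧ E.IsPath y y m}),
      vertex K E y * ghostProd K E l * a = c • vertex K E y + t := by
  classical
  rw [Finsupp.mem_span_image_iff_linearCombination] at ha
  obtain ⟨f, hf, rfl⟩ := ha
  rw [Finsupp.mem_supported] at hf
  have hne : f.support.Nonempty := by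
    rw [Finsupp.support_nonempty_iff]
    rintro rfl
    simp at ha0
  obtain ⟨l, hl, hmin⟩ := Finset.exists_min_image f.support List.length hne
  refine ⟨l, f l, Finsupp.mem_support_iff.mp hl,
    ∑ m ∈ f.support.erase l, f m • (vertex K E y * ghostProd K E l * pathTo K E y m), ?_, ?_⟩
  · refine sum_mem fun m hm => Submodule.smul_mem _ _ ?_
    obtain ⟨hml, hm⟩ := Finset.mem_erase.mp hm
    obtain ⟨x, hx⟩ := hf hm
    rw [mul_assoc]
    by_cases hp : l <+: m
    · obtain ⟨m', rfl⟩ := hp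
      rw [ghostProd_mul_pathTo_append hx]
      obtain ⟨z, -, hz⟩ := hx.exists_of_append
      -- The vertices can differ only for `l = []`, when `m` may start anywhere; the left factor `y`
      -- removes those terms.
      by_cases hzy : z = y
      · subst hzy
        rw [vertex_mul_pathTo hz]
        exact Submodule.subset_span ⟨m', ⟨by rintro rfl; simp at hml, hz⟩, rfl⟩
      · rw [← vertex_mul_pathTo hz, ← mul_assoc, vertex_mul_ne K E (Ne.symm hzy), zero_mul]
        exact zero_mem _
    · rw [ghostProd_mul_pathTo_eq_zero hx (hmin m hm) hp, mul_zero]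
      exact zero_mem _
  · obtain ⟨x, hx⟩ := hf hl
    have h1 : ghostProd K E l * pathTo K E y l = vertex K E y := by
      have := ghostProd_mul_pathTo_append (K := K) (l := l) (m := []) (by simpa using hx)
      simpa [pathTo] using this
    rw [Finsupp.linearCombination_apply, Finsupp.sum, Finset.mul_sum,
      ← Finset.add_sum_erase _ _ hl]
    simp only [mul_smul_comm, mul_assoc, h1, vertex_mul_self]

/-- With two closed simple paths at `y`, a combination of nontrivial closed paths at `y` is killed
by compressing it with a suitable closed path. -/
theorem exists_compression_eq_zero {y : V} {c d : List A} (hc : E.IsClosedSimplePath y c)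
    (hd : E.IsClosedSimplePath y d) (hcd : c ≠ d) {t : LeavittPathAlgebra K E}
    (ht : t ∈ Submodule.span K (pathTo K E y '' {m | m ≠ [] ∧ E.IsPath y y m})) :
    ∃ N, ∀ n, N ≤ n → ghostProd K E (powAppend c d n) * t *
      pathTo K E y (powAppend c d n) = 0 := by
  induction ht using Submodule.span_induction with
  | zero => exact ⟨0, by simp⟩
  | add s t _ _ ihs iht =>
    obtain ⟨M, hM⟩ := ihs
    obtain ⟨N, hN⟩ := iht
    refine ⟨max M N, fun n hn => ?_⟩
    rw [mul_add, add_mul, hM n (le_of_max_le_left hn), hN n (le_of_max_le_right hn), add_zero]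
  | smul k t _ iht =>
    obtain ⟨N, hN⟩ := iht
    exact ⟨N, fun n hn => by rw [mul_smul_comm, smul_mul_assoc, hN n hn, smul_zero]⟩
  | mem t ht =>
    obtain ⟨m, ⟨hm0, hm⟩, rfl⟩ := ht
    refine ⟨m.length, fun n hn => ?_⟩
    have hp := isPath_powAppend hc.2.1 hd.2.1 n
    have h1 : pathTo K E y m * pathTo K E y (powAppend c d n) =
        pathTo K E y (m ++ powAppend c d n) := by
      conv_lhs => rw [pathTo, mul_assoc, vertex_mul_pathTo hp]
      rw [pathTo_append]
    rw [mul_assoc, h1]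
    exact ghostProd_mul_pathTo_eq_zero (hm.append hp) (by simp)
      (not_powAppend_prefix hc hd hcd hm hn le_rfl (Or.inl hm0))

/-- This is where Condition (K) is used: without closed simple paths at `y` there is no nontrivial
closed path and `t = 0`; with two of them, compression removes `t` and keeps `c • y`. -/
theorem vertex_mem_of_smul_vertex_add_mem (hE : E.ConditionK)
    (I : TwoSidedIdeal (LeavittPathAlgebra K E)) {y : V} {c : K} (hc : c ≠ 0)
    {t : LeavittPathAlgebra K E}
    (ht : t ∈ Submodule.span K (pathTo K E y '' {m | m ≠ [] ∧ E.IsPath y y m}))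
    (h : c • vertex K E y + t ∈ I) : vertex K E y ∈ I := by
  rcases hE y with hy | ⟨p, q, hp, hq, hpq⟩
  · have he : {m | m ≠ [] ∧ E.IsPath y y m} = ∅ := by
      refine Set.eq_empty_iff_forall_notMem.mpr fun m hm => hy ?_
      obtain ⟨l, -, -, hl, -⟩ := hm.2.exists_closedSimple_append hm.1
      exact ⟨l, hl⟩
    rw [he] at ht
    obtain rfl : t = 0 := by simpa using ht
    exact mem_of_smul_mem_ideal I hc (by simpa using h)
  · obtain ⟨n, hn⟩ := exists_compression_eq_zero hp hq hpq ht
    have hpath := isPath_powAppend hp.2.1 hq.2.1 n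
    have h1 : ghostProd K E (powAppend p q n) * pathTo K E y (powAppend p q n) =
        vertex K E y := by
      have := ghostProd_mul_pathTo_append (K := K) (l := powAppend p q n) (m := [])
        (by simpa using hpath)
      simpa [pathTo] using this
    have h2 := I.mul_mem_right _ (pathTo K E y (powAppend p q n))
      (I.mul_mem_left (ghostProd K E (powAppend p q n)) _ h)
    rw [mul_add, add_mul, hn n le_rfl, add_zero, mul_smul_comm, smul_mul_assoc, mul_assoc,
      vertex_mul_pathTo hpath, h1] at h2
    exact mem_of_smul_mem_ideal I hc h2

/-- Under Condition (K), an ideal is generated by its vertices. -/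
theorem eq_span_vertices (hE : E.ConditionK) (I : TwoSidedIdeal (LeavittPathAlgebra K E)) :
    I = TwoSidedIdeal.span {a | a ∈ I ∧ ∃ y, a = vertex K E y} := by
  refine le_antisymm (fun a ha => ?_) (TwoSidedIdeal.span_le.mpr fun a ha => ha.1)
  by_contra haJ
  set J := TwoSidedIdeal.span {a | a ∈ I ∧ ∃ y, a = vertex K E y}
  obtain ⟨n, hn⟩ := exists_mem_ghostFiltration a
  obtain ⟨b, hb, hb0⟩ := exists_mul_mem_ghostFiltration_zero J hn haJ
  obtain ⟨y, hy⟩ : ∃ y, a * b * vertex K E y ∉ J := by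
    by_contra! h
    apply hb
    rw [← mul_one (a * b), one_eq_sum, Finset.mul_sum]
    exact sum_mem fun y _ => h y
  obtain ⟨l, c, hc, t, ht, heq⟩ := exists_ghostProd_mul_eq
    (by intro h0; rw [h0] at hy; exact hy (zero_mem _)) (mul_vertex_mem_span_pathTo hb0 y)
  have hI : c • vertex K E y + t ∈ I := by
    rw [← heq, mul_assoc a]
    exact I.mul_mem_left _ _ (I.mul_mem_right _ _ ha)
  have hyI := vertex_mem_of_smul_vertex_add_mem hE I hc ht hI
  exact hy (J.mul_mem_left _ _ (TwoSidedIdeal.subset_span ⟨hyI, y, rfl⟩))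

theorem isGradedIdeal_of_conditionK (hE : E.ConditionK)
    (I : TwoSidedIdeal (LeavittPathAlgebra K E)) : IsGradedIdeal K E I := by
  rw [eq_span_vertices hE I]
  refine isHomogeneous_span_of_isHomogeneousElem K E ?_
  rintro a ⟨-, y, rfl⟩
  exact ⟨0, gen_mem K E (.vertex y)⟩

end Reduction
end LeavittPathAlgebra

/-! ### Infinite paths through a vertex infinitely often -/

namespace DirGraph

variable {V : Type u} {A : Type v} (E : DirGraph V A)

/-- The infinite paths that visit the vertex `x` infinitely often. -/
@[ext]
structure RecurrentPath (x : V) where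
  /-- the edges of the path -/
  edge : ℕ → A
  chain : ∀ n, E.range (edge n) = E.source (edge (n + 1))
  recurrent : ∀ n, ∃ m, n ≤ m ∧ E.source (edge m) = x

namespace RecurrentPath

variable {E} {x : V}

/-- Remove the first `k` edges. -/
def drop (k : ℕ) (p : E.RecurrentPath x) : E.RecurrentPath x where
  edge n := p.edge (k + n)
  chain n := p.chain (k + n)
  recurrent n := by
    obtain ⟨m, hm, h⟩ := p.recurrent (k + n)
    exact ⟨m - k, by omega, by rwa [Nat.add_sub_cancel' (by omega)]⟩

/-- Prepend an edge. -/
def cons (e : A) (p : E.RecurrentPath x) (h : E.range e = E.source (p.edge 0)) :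
    E.RecurrentPath x where
  edge n := Nat.casesOn n e p.edge
  chain n := by
    cases n with
    | zero => exact h
    | succ n => exact p.chain n
  recurrent n := by
    obtain ⟨m, hm, h⟩ := p.recurrent n
    exact ⟨m + 1, by omega, h⟩

@[simp] theorem cons_edge_zero (e : A) (p : E.RecurrentPath x) (h) : (p.cons e h).edge 0 = e := rfl

@[simp] theorem drop_one_cons (e : A) (p : E.RecurrentPath x) (h) : (p.cons e h).drop 1 = p := by
  ext n
  simp only [drop, cons]
  rw [Nat.add_comm]

theorem cons_drop_one (p : E.RecurrentPath x) (h) : (p.drop 1).cons (p.edge 0) h = p := by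
  ext n
  cases n with
  | zero => rfl
  | succ n => simp only [drop, cons]; rw [Nat.add_comm]

theorem drop_drop_one (p : E.RecurrentPath x) (k : ℕ) : (p.drop 1).drop k = p.drop (k + 1) := by
  ext n
  simp only [drop]
  congr 1
  omega

theorem isPath_take (p : E.RecurrentPath x) (k : ℕ) :
    E.IsPath (E.source (p.edge 0)) (E.source (p.edge k)) ((List.range k).map p.edge) := by
  induction k with
  | zero => rfl
  | succ k ih =>
    rw [List.range_succ, List.map_append, ← p.chain k]
    exact E.isPath_concat ih rfl

theorem exists_isClosedSimplePath (p : E.RecurrentPath x) (h : E.source (p.edge 0) = x) :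
    ∃ k, E.source (p.edge k) = x ∧ E.IsClosedSimplePath x ((List.range k).map p.edge) := by
  classical
  -- Recurrence from index 1 on skips the visit at time 0; the least such `k` is the first return.
  have hex : ∃ k, 1 ≤ k ∧ E.source (p.edge k) = x := p.recurrent 1
  obtain ⟨hk, hkx⟩ := Nat.find_spec hex
  have hmin := fun m => Nat.find_min (m := m) hex
  generalize Nat.find hex = k at hk hkx hmin
  refine ⟨k, hkx, ?_, ?_, ?_⟩
  · simp only [ne_eq, List.map_eq_nil_iff, List.range_eq_nil]
    omega
  · have := p.isPath_take k
    rwa [h, hkx] at this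
  · intro e he
    obtain ⟨k, rfl⟩ : ∃ j, k = j + 1 := ⟨k - 1, by omega⟩
    simp only [List.range_succ_eq_map, List.map_cons, List.map_map, List.tail_cons, List.mem_map,
      List.mem_range, Function.comp_apply] at he
    obtain ⟨i, hi, rfl⟩ := he
    exact fun hx => hmin (i + 1) (by omega) ⟨by omega, hx⟩

variable {l : List A}

theorem take_eq_of_unique (hu : ∀ l', E.IsClosedSimplePath x l' → l' = l)
    (p : E.RecurrentPath x) (h : E.source (p.edge 0) = x) :
    E.source (p.edge l.length) = x ∧ (List.range l.length).map p.edge = l := by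
  obtain ⟨k, hk, hc⟩ := p.exists_isClosedSimplePath h
  have hkl := hu _ hc
  have hlen : k = l.length := by simpa using congrArg List.length hkl
  subst hlen
  exact ⟨hk, hkl⟩

/-- Each return to `x` runs through `l`, so a recurrent path from `x` is `l` repeated forever.
Recurrence is essential: a path that leaves the cycle for good would be a second infinite path from
`x`. -/
theorem eq_of_unique (hl : l ≠ []) (hu : ∀ l', E.IsClosedSimplePath x l' → l' = l)
    {p q : E.RecurrentPath x} (hp : E.source (p.edge 0) = x) (hq : E.source (q.edge 0) = x) :
    p = q := by
  ext n
  induction n using Nat.strong_induction_on generalizing p q with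
  | _ n ih =>
    obtain ⟨hp1, hp2⟩ := take_eq_of_unique hu p hp
    obtain ⟨hq1, hq2⟩ := take_eq_of_unique hu q hq
    have hpos := List.length_pos_iff.mpr hl
    by_cases hn : n < l.length
    · have := hp2.trans hq2.symm
      rw [List.map_inj_left] at this
      exact this n (List.mem_range.mpr hn)
    · have := ih (n - l.length) (by omega) (p := p.drop l.length) (q := q.drop l.length) hp1 hq1
      simp only [drop] at this
      rwa [Nat.add_sub_cancel' (by omega)] at this

end RecurrentPath

variable {E}

theorem IsPath.range_getElem {x y : V} {l : List A} (h : E.IsPath x y l) (i : ℕ)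
    (hi : i < l.length) :
    E.range l[i] = y ∧ i + 1 = l.length ∨ ∃ hi' : i + 1 < l.length,
      E.range l[i] = E.source l[i + 1] := by
  induction l generalizing x i with
  | nil => simp at hi
  | cons e l ih =>
    cases i with
    | zero =>
      cases l with
      | nil => exact Or.inl ⟨h.2, rfl⟩
      | cons f l => exact Or.inr ⟨by simp, h.2.1.symm⟩
    | succ i =>
      rcases ih h.2 i (by simpa using hi) with ⟨h1, h2⟩ | ⟨h1, h2⟩
      · exact Or.inl ⟨by simpa using h1, by simpa using h2⟩
      · exact Or.inr ⟨by simpa using h1, by simpa using h2⟩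

theorem IsPath.source_getElem_zero {x y : V} {l : List A} (h : E.IsPath x y l)
    (hl : 0 < l.length) : E.source l[0] = x := by
  cases l with
  | nil => simp at hl
  | cons e l => exact h.1

/-- The infinite path that runs around a closed path forever. -/
def RecurrentPath.periodic {x : V} {l : List A} (h : E.IsPath x x l) (hl : 0 < l.length) :
    E.RecurrentPath x where
  edge n := l[n % l.length]'(Nat.mod_lt _ hl)
  chain n := by
    rcases h.range_getElem (n % l.length) (Nat.mod_lt _ hl) with ⟨h1, h2⟩ | ⟨h1, h2⟩
    · have h3 : (n + 1) % l.length = 0 := by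
        rw [Nat.add_mod, ← Nat.add_mod_mod, Nat.mod_mod, Nat.add_mod_mod, h2, Nat.mod_self]
      simp only [h3, h1, h.source_getElem_zero hl]
    · have h3 : (n + 1) % l.length = n % l.length + 1 := by
        rw [Nat.add_mod, ← Nat.add_mod_mod, Nat.mod_mod, Nat.add_mod_mod, Nat.mod_eq_of_lt h1]
      simp only [h3, h2]
  recurrent n := by
    refine ⟨l.length * n, Nat.le_mul_of_pos_left n hl, ?_⟩
    simp only [Nat.mul_mod_right, h.source_getElem_zero hl]

theorem RecurrentPath.source_periodic_zero {x : V} {l : List A} (h : E.IsPath x x l)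
    (hl : 0 < l.length) : E.source ((periodic h hl).edge 0) = x := by
  simp only [periodic, Nat.zero_mod, h.source_getElem_zero hl]

end DirGraph

namespace LeavittPathAlgebra

open DirGraph

/-! ### The signed representation on functions on recurrent paths -/

section Representation

variable (K : Type w) [Field K] {V : Type u} {A : Type v} (E : DirGraph V A) (x : V) (σ : A → K)

open Classical in
/-- The action of a generator on functions on recurrent paths, where the edge `e` prepends itself to
a path and multiplies by the scalar `σ e` with `σ e * σ e = 1`. -/
noncomputable def genAction : LeavittGen V A → Module.End K (E.RecurrentPath x → K)
  | .vertex y =>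
    { toFun := fun f p => if E.source (p.edge 0) = y then f p else 0
      map_add' := fun f g => by ext p; simp only [Pi.add_apply]; split_ifs <;> simp
      map_smul' := fun c f => by ext p; simp }
  | .edge e =>
    { toFun := fun f p => if p.edge 0 = e then σ e * f (p.drop 1) else 0
      map_add' := fun f g => by ext p; simp only [Pi.add_apply]; split_ifs <;> simp [mul_add]
      map_smul' := fun c f => by
        ext p; simp only [Pi.smul_apply, smul_eq_mul, RingHom.id_apply]; split_ifs <;> ring }
  | .ghost e =>
    { toFun := fun f p => if h : E.range e = E.source (p.edge 0) then σ e * f (p.cons e h) else 0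
      map_add' := fun f g => by ext p; simp only [Pi.add_apply]; split_ifs <;> simp [mul_add]
      map_smul' := fun c f => by
        ext p; simp only [Pi.smul_apply, smul_eq_mul, RingHom.id_apply]; split_ifs <;> ring }

open Classical in
theorem genAction_vertex_apply (y : V) (f : E.RecurrentPath x → K) (p : E.RecurrentPath x) :
    genAction K E x σ (.vertex y) f p = if E.source (p.edge 0) = y then f p else 0 := rfl

open Classical in
theorem genAction_edge_apply (e : A) (f : E.RecurrentPath x → K) (p : E.RecurrentPath x) :
    genAction K E x σ (.edge e) f p = if p.edge 0 = e then σ e * f (p.drop 1) else 0 := rfl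

open Classical in
theorem genAction_ghost_apply (e : A) (f : E.RecurrentPath x → K) (p : E.RecurrentPath x) :
    genAction K E x σ (.ghost e) f p =
      if h : E.range e = E.source (p.edge 0) then σ e * f (p.cons e h) else 0 := rfl

variable [Fintype V] [Fintype A] {σ}

open Classical in
-- The Cuntz–Krieger relations hold because a recurrent path is the same as its first edge together
-- with its tail. The scalar `σ e` is its own inverse, so edge and ghost edge can share it. No
-- recurrent path starts at a sink, so sinks act as zero.
theorem lift_genAction_rel (hσ : ∀ e, σ e * σ e = 1) ⦃a b : FreeAlgebra K (LeavittGen V A)⦄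
    (h : LeavittRel K E a b) : FreeAlgebra.lift K (genAction K E x σ) a =
      FreeAlgebra.lift K (genAction K E x σ) b := by
  induction h with
  | one =>
    ext f p
    simp [genAction_vertex_apply]
  | vertex_mul_self y =>
    ext f p
    simp only [map_mul, FreeAlgebra.lift_ι_apply, Module.End.mul_apply, genAction_vertex_apply]
    split_ifs <;> rfl
  | vertex_mul_ne y z h =>
    ext f p
    simp only [map_mul, FreeAlgebra.lift_ι_apply, Module.End.mul_apply, genAction_vertex_apply,
      map_zero, LinearMap.zero_apply, Pi.zero_apply]
    split_ifs with h1 h2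
    · exact absurd (h1.symm.trans h2) h
    · rfl
    · rfl
  | source_mul_edge e =>
    ext f p
    simp only [map_mul, FreeAlgebra.lift_ι_apply, Module.End.mul_apply, genAction_vertex_apply,
      genAction_edge_apply]
    split_ifs with h1 h2 h2
    · rfl
    · rfl
    · exact absurd (congrArg E.source h2) h1
    · rfl
  | edge_mul_range e =>
    ext f p
    simp only [map_mul, FreeAlgebra.lift_ι_apply, Module.End.mul_apply, genAction_vertex_apply,
      genAction_edge_apply]
    split_ifs with h1 h2
    · rfl
    · exact absurd (h1 ▸ p.chain 0).symm h2
    · rfl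
  | range_mul_ghost e =>
    ext f p
    simp only [map_mul, FreeAlgebra.lift_ι_apply, Module.End.mul_apply, genAction_vertex_apply,
      genAction_ghost_apply]
    split_ifs with h1 h2 h2
    · rfl
    · exact absurd h1.symm h2
    · exact absurd h2.symm h1
    · rfl
  | ghost_mul_source e =>
    ext f p
    simp [genAction_vertex_apply, genAction_ghost_apply]
  | ck1_self e =>
    ext f p
    simp [genAction_vertex_apply, genAction_ghost_apply, genAction_edge_apply, ← mul_assoc, hσ,
      eq_comm]
  | ck1_ne e g h =>
    ext f p
    simp [genAction_ghost_apply, genAction_edge_apply, h]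
  | ck2 y h =>
    ext f p
    -- `e e*` acts as the projection to functions supported on paths with first edge `e`.
    have h1 : ∀ e, genAction K E x σ (.edge e) (genAction K E x σ (.ghost e) f) p =
        if p.edge 0 = e then f p else 0 := by
      intro e
      rw [genAction_edge_apply]
      split_ifs with h1
      · subst h1
        have h2 : E.range (p.edge 0) = E.source ((p.drop 1).edge 0) := p.chain 0
        rw [genAction_ghost_apply, dif_pos h2, RecurrentPath.cons_drop_one, ← mul_assoc, hσ,
          one_mul]
      · rfl
    simp only [map_mul, map_sum, FreeAlgebra.lift_ι_apply, LinearMap.sum_apply, Finset.sum_apply,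
      Module.End.mul_apply, h1, genAction_vertex_apply, Finset.sum_ite_eq, Finset.mem_filter,
      Finset.mem_univ, true_and]

/-- The representation of `L_K(E)` on functions on recurrent paths, twisted by signs. -/
noncomputable def recurrentRep (hσ : ∀ e, σ e * σ e = 1) :
    LeavittPathAlgebra K E →ₐ[K] Module.End K (E.RecurrentPath x → K) :=
  RingQuot.liftAlgHom K ⟨FreeAlgebra.lift K (genAction K E x σ), lift_genAction_rel K E x hσ⟩

theorem recurrentRep_gen (hσ : ∀ e, σ e * σ e = 1) (g : LeavittGen V A) :
    recurrentRep K E x hσ (gen K E g) = genAction K E x σ g := by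
  simp [recurrentRep, gen]

open Classical in
theorem recurrentRep_vertex_apply (hσ : ∀ e, σ e * σ e = 1) (y : V) (f : E.RecurrentPath x → K)
    (p : E.RecurrentPath x) : recurrentRep K E x hσ (vertex K E y) f p =
      if E.source (p.edge 0) = y then f p else 0 := by
  rw [vertex, recurrentRep_gen, genAction_vertex_apply]

theorem recurrentRep_prod_apply (hσ : ∀ e, σ e * σ e = 1) (l : List A)
    (f : E.RecurrentPath x → K) (p : E.RecurrentPath x)
    (hp : (List.range l.length).map p.edge = l) :
    recurrentRep K E x hσ (l.map (edge K E)).prod f p =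
      (l.map σ).prod * f (p.drop l.length) := by
  induction l generalizing p with
  | nil =>
    have : p.drop 0 = p := by ext n; simp [RecurrentPath.drop]
    simp [this]
  | cons e l ih =>
    simp only [List.length_cons, List.range_succ_eq_map, List.map_cons, List.map_map,
      List.cons.injEq] at hp
    have h2 : (List.range l.length).map (p.drop 1).edge = l := by
      conv_rhs => rw [← hp.2]
      refine List.map_congr_left fun i _ => ?_
      simp [RecurrentPath.drop, Nat.add_comm]
    rw [List.map_cons, List.prod_cons, map_mul, Module.End.mul_apply, edge, recurrentRep_gen,
      genAction_edge_apply, if_pos hp.1, ih _ h2, RecurrentPath.drop_drop_one]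
    simp [mul_assoc]

variable {E x}

/-- If `l` is the only closed simple path at `x`, then the ideal generated by `x + l` is not
graded. -/
theorem not_isGradedIdeal_span_vertex_add_path {l : List A} (hl : E.IsClosedSimplePath x l)
    (hu : ∀ l', E.IsClosedSimplePath x l' → l' = l) :
    ¬ IsGradedIdeal K E (TwoSidedIdeal.span {vertex K E x + path K E x l}) := by
  classical
  intro hgr
  have hpos := List.length_pos_iff.mpr hl.1
  set I := TwoSidedIdeal.span {vertex K E x + path K E x l}
  -- `l` has positive degree, so the degree-0 component of the generator is `x`.
  have hx : vertex K E x ∈ I := by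
    have h1 := hgr 0 (TwoSidedIdeal.subset_span (s := {vertex K E x + path K E x l}) rfl)
    have hv : vertex K E x ∈ component K E 0 := gen_mem K E (.vertex x)
    have hp : path K E x l ∈ component K E l.length := by
      refine Submodule.subset_span ⟨x, x, x, l, [], hl.2.1, rfl, by simp, ?_⟩
      rw [path_eq_pathTo hl.2.1]
      simp [pathTo, ghostPath, mul_assoc, vertex_mul_self]
    rw [DirectSum.decompose_add, DirectSum.add_apply, AddMemClass.coe_add,
      DirectSum.decompose_of_mem_same _ hv, DirectSum.decompose_of_mem_ne _ hp (by omega),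
      add_zero] at h1
    exact h1
  obtain ⟨e, m, rfl⟩ := List.exists_cons_of_ne_nil hl.1
  -- The first edge of a closed simple path does not recur in it, since later edges do not leave
  -- from `x`; hence the total sign is `-1`. In characteristic 2 the twist is trivial and nothing
  -- changes.
  let σ : A → K := fun f => if f = e then -1 else 1
  have hσ : ∀ f, σ f * σ f = 1 := fun f => by simp only [σ]; split_ifs <;> simp
  have hσl : ((e :: m).map σ).prod = -1 := by
    have h1 : m.map σ = m.map fun _ => 1 := by
      refine List.map_congr_left fun f hf => if_neg ?_
      rintro rfl
      exact hl.2.2 f hf hl.2.1.1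
    rw [List.map_cons, List.prod_cons, h1]
    simp [σ]
  have hker : I ≤ TwoSidedIdeal.ker (recurrentRep K E x hσ) := by
    refine TwoSidedIdeal.span_le.mpr ?_
    rintro a rfl
    rw [SetLike.mem_coe, TwoSidedIdeal.mem_ker]
    ext f p
    rw [map_add, LinearMap.add_apply, Pi.add_apply, path, map_mul, Module.End.mul_apply,
      recurrentRep_vertex_apply, recurrentRep_vertex_apply]
    split_ifs with hp
    · obtain ⟨h1, h2⟩ := RecurrentPath.take_eq_of_unique hu p hp
      -- After one turn around the cycle the path is again recurrent from `x`, so it is the same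
      -- path and `l` acts as the scalar `-1` there.
      have hd : p.drop (e :: m).length = p := RecurrentPath.eq_of_unique hl.1 hu h1 hp
      rw [recurrentRep_prod_apply K E x hσ _ _ _ h2, hσl, hd]
      simp
    · simp
  have h0 := (TwoSidedIdeal.mem_ker _).mp (hker hx)
  -- The constant function 1, evaluated at the periodic path from `x`, shows that `x` acts
  -- nontrivially.
  have h1 := congrFun (LinearMap.congr_fun h0 fun _ => 1)
    (RecurrentPath.periodic hl.2.1 hpos)
  rw [recurrentRep_vertex_apply, if_pos (RecurrentPath.source_periodic_zero hl.2.1 hpos)] at h1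
  exact one_ne_zero h1

end Representation

end LeavittPathAlgebra

theorem theorem2 {V : Type u} {A : Type v} [Fintype V] [Fintype A] (E : DirGraph V A)
    (K : Type w) [Field K] :
    ((∀ I : TwoSidedIdeal (LeavittPathAlgebra K E), LeavittPathAlgebra.IsGradedIdeal K E I) ↔
      E.ConditionK) ∧
    (∀ (x : V) (l : List A), E.IsClosedSimplePath x l →
      (∀ l', E.IsClosedSimplePath x l' → l' = l) →
      ¬ LeavittPathAlgebra.IsGradedIdeal K E (TwoSidedIdeal.span
        {LeavittPathAlgebra.vertex K E x + LeavittPathAlgebra.path K E x l})) := by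
  have hnot := fun (x : V) (l : List A) (hl : E.IsClosedSimplePath x l) hu =>
    LeavittPathAlgebra.not_isGradedIdeal_span_vertex_add_path K hl hu
  refine ⟨⟨fun h x => ?_, fun hE I => LeavittPathAlgebra.isGradedIdeal_of_conditionK hE I⟩, hnot⟩
  -- Failure of (K) at `x` means that a closed simple path exists and any two coincide.
  by_contra! hx
  obtain ⟨⟨l, hl⟩, hu⟩ := hx
  exact hnot x l hl (fun l' hl' => hu l' l hl' hl) (h _)
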